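/- For sets $A,B\subseteq\mathbb N$ write $A\le_1 B$ if there is a total computable injective function $f:\mathbb N\to\mathbb N$ with $x\in A\iff f(x)\in B$ for all $x\in\mathbb N$. Write $A\le_{\mathrm{bfo}}B$ if there are a total computable function $f:\mathbb N\to\mathbb N$ and a constant $c\ge 1$ such that $x\in A\iff f(x)\in B$ for all $x\in\mathbb N$ and $|f^{-1}(y)|\le c$ for all $y\in\mathbb N$. For $r\in\{1,\mathrm{bfo}\}$ let $A\equiv_r B$ mean that $A\le_r B$ and $B\le_r A$. The equivalence classes of $\equiv_1$ are the $1$-degrees, partially ordered by $\deg_1(A)\le\deg_1(B)\iff A\le_1 B$; the equivalence classes of $\equiv_{\mathrm{bfo}}$ are the bounded finite-one degrees. Since $A\le_1 B$ implies $A\le_{\mathrm{bfo}}B$, every bounded finite-one degree is a union of $1$-degrees. **Corollary 3.10 (Universal countable partial orders).** There exists a nonrecursive set $A\subseteq\mathbb N$ with $A\le_T\emptyset'$ such that for every countable partial order $(P,\le_P)$ there is an order embedding of $P$ into the partially ordered set of $1$-degrees contained in the bounded finite-one degree of $A$, that is, a map $\Phi$ from $P$ to these $1$-degrees with $p\le_P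 q\iff\Phi(p)\le\Phi(q)$ for all $p,q\in P$. -/

import Mathlib

/-- The characteristic function of a set of natural numbers: `1` on the set, `0` off it. -/
noncomputable def charFun (A : Set ℕ) : ℕ → ℕ := A.indicator 1

/-- `A ≤_T B`: the characteristic function of `A` is recursive in that of `B`. -/
def SetTuringReducible (A B : Set ℕ) : Prop :=
  TuringReducible (charFun A : ℕ →. ℕ) (charFun B : ℕ →. ℕ)

/-- The Turing jump `∅′` of the empty set: the diagonal halting set `{e | φ_e(e)↓}`, for
Mathlib's standard numbering of the partial recursive functions. -/
def emptyJump : Set ℕ :=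
  {e | ((Denumerable.ofNat Nat.Partrec.Code e).eval e).Dom}

/-- `A` is recursive (computable). -/
def IsRecursive (A : Set ℕ) : Prop := ComputablePred fun n => n ∈ A

/-- `A ≤_1 B`: there is a total computable injective `f` with `x ∈ A ↔ f x ∈ B`. -/
def OneReducible (A B : Set ℕ) : Prop :=
  OneOneReducible (fun n => n ∈ A) (fun n => n ∈ B)

/-- `A ≤_bfo B`: there are a total computable `f` with `x ∈ A ↔ f x ∈ B` and a constant `c ≥ 1`
such that every fibre of `f` is finite with at most `c` elements. -/
def BFOReducible (A B : Set ℕ) : Prop :=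
  ∃ (f : ℕ → ℕ) (c : ℕ), Computable f ∧ 1 ≤ c ∧ (∀ x, x ∈ A ↔ f x ∈ B) ∧
    ∀ y, (f ⁻¹' {y}).encard ≤ c

/-- `A ≡_bfo B`. -/
def BFOEquiv (A B : Set ℕ) : Prop := BFOReducible A B ∧ BFOReducible B A

/-- The bounded finite-one degree of `A`: the class of all sets `B` with `B ≡_bfo A`. -/
def bfoDegree (A : Set ℕ) : Set (Set ℕ) := {B | BFOEquiv B A}

/-- `A ≡_1 B` as an equivalence relation on sets of natural numbers. -/
def oneSetoid : Setoid (Set ℕ) where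
  r A B := OneReducible A B ∧ OneReducible B A
  iseqv :=
    { refl := fun _ => ⟨oneOneReducible_refl _, oneOneReducible_refl _⟩
      symm := fun h => ⟨h.2, h.1⟩
      trans := fun h k => ⟨OneOneReducible.trans h.1 k.1, OneOneReducible.trans k.2 h.2⟩ }

/-- The `1`-degrees: equivalence classes of sets of natural numbers under `≡_1`. -/
def OneDegree : Type := Quotient oneSetoid

/-- The `1`-degree of a set. -/
def oneDeg (A : Set ℕ) : OneDegree := Quotient.mk oneSetoid A

/-- The `1`-degrees are ordered by `deg_1 A ≤ deg_1 B ↔ A ≤_1 B`. -/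
instance : PartialOrder OneDegree where
  le := Quotient.lift₂ OneReducible fun _ _ _ _ h k => propext
    ⟨fun t => OneOneReducible.trans (OneOneReducible.trans h.2 t) k.1,
      fun t => OneOneReducible.trans (OneOneReducible.trans h.1 t) k.2⟩
  le_refl := by
    rintro ⟨A⟩
    exact oneOneReducible_refl _
  le_trans := by
    rintro ⟨A⟩ ⟨B⟩ ⟨C⟩ h k
    exact OneOneReducible.trans h k
  le_antisymm := by
    rintro ⟨A⟩ ⟨B⟩ h k
    exact Quotient.sound ⟨h, k⟩

theorem oneDeg_le_oneDeg {A B : Set ℕ} : oneDeg A ≤ oneDeg B ↔ OneReducible A B := Iff.rfl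

/-- The `1`-degrees contained, as classes of sets, in the bounded finite-one degree of `A`.
As a set of `1`-degrees it carries the induced order. -/
def oneDegreesIn (A : Set ℕ) : Set OneDegree :=
  {d | {B | oneDeg B = d} ⊆ bfoDegree A}

/-! Call `R` rigid if each computable self-reduction of `R` is the identity from some point on. A
rigid `R ≤_T ∅'` comes from finite extensions: stage `e` seeks an undecided `x` with `φ_e x ≠ x` and
puts exactly one of `x`, `φ_e x` into `R`. If there is none, `φ_e` is already the identity wherever
it is defined on undecided numbers. The halting set tells which case holds.

For computable `s`, `duplicate R s` carries a copy of `R` at the numbers `3x` and a second copy at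
`3x + 1` for `x` in `s`. Folding second copies onto first ones has fibres of size at most two, so
all these sets share a bounded finite-one degree. If `s ⊆ t` then `duplicate R s ≤_1 duplicate R t`.
Conversely, rigidity makes a 1-reduction send both copies of a large `x` to copies of the same `x`,
so injectivity forces `s ⊆ t` up to finitely many elements
(`IsRigid.eventually_imp_of_duplicate_oneReducible`).

It remains to represent a countable order by computable sets with `i ≤ j` giving true inclusion and
`i ≰ j` an infinite difference (`exists_computable_family`). Each number `x` selects an up-set, and
every up-set is matched on any initial segment of indices by arbitrarily large `x`. -/

/-! ### Searches and stage constructions recursive in the halting set -/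

theorem Nat.RecursiveIn.comp_total {O : Set (ℕ →. ℕ)} {f : ℕ →. ℕ} {h : ℕ → ℕ}
    (hf : Nat.RecursiveIn O f) (hh : Nat.RecursiveIn O (h : ℕ →. ℕ)) :
    Nat.RecursiveIn O fun n => f (h n) :=
  (hf.comp hh).of_eq fun _ => Part.bind_some _ _

theorem Nat.RecursiveIn.pair_total {O : Set (ℕ →. ℕ)} {f h : ℕ → ℕ}
    (hf : Nat.RecursiveIn O (f : ℕ →. ℕ)) (hh : Nat.RecursiveIn O (h : ℕ →. ℕ)) :
    Nat.RecursiveIn O ((fun n => Nat.pair (f n) (h n) : ℕ → ℕ) : ℕ →. ℕ) :=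
  (hf.pair hh).of_eq fun _ => by simp [Seq.seq]

open Nat.Partrec (Code) in
/-- The halting set decides, uniformly in `m`, whether an effective search succeeds. -/
theorem exists_computable_mem_emptyJump_iff_rfindOpt_dom {t : ℕ → ℕ → Option ℕ}
    (ht : Computable₂ t) :
    ∃ q : ℕ → ℕ, Computable q ∧ ∀ m, q m ∈ emptyJump ↔ (Nat.rfindOpt (t m)).Dom := by
  have hp : Nat.Partrec fun n : ℕ => Nat.rfindOpt (t n.unpair.1) := by
    refine Partrec.nat_iff.1 ?_
    exact Partrec.rfindOpt (ht.comp₂ ((Computable.fst.comp Computable.unpair).comp Computable.fst).to₂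
      Computable.snd.to₂)
  obtain ⟨c, hc⟩ := Code.exists_code.1 hp
  refine ⟨fun m => Encodable.encode (Code.curry c m), ?_, fun m => ?_⟩
  · exact Computable.encode.comp
      (Code.primrec₂_curry.comp (Primrec.const c) Primrec.id).to_comp
  · simp [emptyJump, Code.eval_curry, hc]

open Classical in
/-- The value found by the search `t m`, or `d m` if the search fails. -/
noncomputable def searchOrElse (t : ℕ → ℕ → Option ℕ) (d : ℕ → ℕ) (m : ℕ) : ℕ :=
  (Nat.rfindOpt (t m)).getOrElse (d m)

theorem searchOrElse_spec (t : ℕ → ℕ → Option ℕ) (d : ℕ → ℕ) (m : ℕ) :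
    (∃ k, searchOrElse t d m ∈ t m k) ∨ (searchOrElse t d m = d m ∧ ∀ k, t m k = none) := by
  classical
  by_cases h : (Nat.rfindOpt (t m)).Dom
  · left
    apply Nat.rfindOpt_spec
    rw [searchOrElse, Part.getOrElse_of_dom _ h]
    exact Part.get_mem h
  · right
    refine ⟨Part.getOrElse_of_not_dom _ h _, fun k => ?_⟩
    rw [Nat.rfindOpt_dom] at h
    push Not at h
    exact Option.eq_none_iff_forall_not_mem.2 (h k)

/-- One oracle bit says whether the search halts. Given that bit, a partial recursive function
either runs the search or returns the default, so it never diverges. -/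
theorem recursiveIn_searchOrElse {t : ℕ → ℕ → Option ℕ} {d : ℕ → ℕ}
    (ht : Computable₂ t) (hd : Computable d) :
    Nat.RecursiveIn {(charFun emptyJump : ℕ →. ℕ)} (searchOrElse t d : ℕ →. ℕ) := by
  classical
  obtain ⟨q, hq, hqt⟩ := exists_computable_mem_emptyJump_iff_rfindOpt_dom ht
  have hF : Nat.Partrec fun n : ℕ => bif n.unpair.2 == 0 then Part.some (d n.unpair.1)
      else Nat.rfindOpt (t n.unpair.1) := by
    refine Partrec.nat_iff.1 ?_
    have h1 := Computable.fst.comp Computable.unpair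
    refine Partrec.cond ?_ (hd.comp h1).partrec ?_
    · exact (Primrec.beq.comp (Primrec.snd.comp Primrec.unpair) (Primrec.const 0)).to_comp
    · exact Partrec.rfindOpt (ht.comp₂ (h1.comp Computable.fst).to₂ Computable.snd.to₂)
  have hQ : Nat.RecursiveIn {(charFun emptyJump : ℕ →. ℕ)} (q : ℕ →. ℕ) :=
    (Partrec.nat_iff.1 hq.partrec).recursiveIn
  have hI : Nat.RecursiveIn {(charFun emptyJump : ℕ →. ℕ)} ((id : ℕ → ℕ) : ℕ →. ℕ) :=
    Nat.Primrec.id.recursiveIn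
  have hO : Nat.RecursiveIn {(charFun emptyJump : ℕ →. ℕ)}
      ((fun m => charFun emptyJump (q m) : ℕ → ℕ) : ℕ →. ℕ) :=
    (Nat.RecursiveIn.oracle _ (Set.mem_singleton _)).comp_total hQ
  refine (hF.recursiveIn.comp_total (hI.pair_total hO)).of_eq fun m => ?_
  by_cases h : (Nat.rfindOpt (t m)).Dom
  · have h1 : charFun emptyJump (q m) = 1 := by simp [charFun, (hqt m).2 h]
    simp [h1, searchOrElse, Part.getOrElse_of_dom _ h]
  · have h1 : charFun emptyJump (q m) = 0 := by simp [charFun, (hqt m).not.2 h]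
    simp [h1, searchOrElse, Part.getOrElse_of_not_dom _ h]

/-- Iterating a stage function from `0`; the stage function receives the pair of the stage number
and the current state. -/
def stageState (g : ℕ → ℕ) : ℕ → ℕ
  | 0 => 0
  | n + 1 => g (Nat.pair n (stageState g n))

theorem recursiveIn_stageState {O : Set (ℕ →. ℕ)} {g : ℕ → ℕ}
    (hg : Nat.RecursiveIn O (g : ℕ →. ℕ)) : Nat.RecursiveIn O (stageState g : ℕ →. ℕ) := by
  have hI : Nat.RecursiveIn O ((id : ℕ → ℕ) : ℕ →. ℕ) := Nat.Primrec.id.recursiveIn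
  have hZ : Nat.RecursiveIn O ((fun _ => 0 : ℕ → ℕ) : ℕ →. ℕ) := Nat.RecursiveIn.zero
  refine ((hZ.prec (hg.comp_total Nat.RecursiveIn.right)).comp_total
    (hZ.pair_total hI)).of_eq fun n => ?_
  induction n with
  | zero => simp [stageState]
  | succ n ih =>
    simp only [Nat.unpair_pair, id] at ih ⊢
    rw [ih]
    simp [stageState]

/-- A set is rigid if each of its computable self-reductions fixes all but finitely many
numbers. -/
def IsRigid (A : Set ℕ) : Prop :=
  ∀ f : ℕ → ℕ, Computable f → (∀ x, x ∈ A ↔ f x ∈ A) → ∃ L, ∀ x, L ≤ x → f x = x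

/-! ### Finite-extension construction of a rigid set -/

namespace RigidConstruction

open Nat.Partrec (Code)

/-- Code of the stage after the bits below `x + y + L + 1` have been decided so that `x` and `y`
lie on different sides of the set, where the set bits of `a` are the elements found before. -/
def separate (L a x y : ℕ) : ℕ :=
  Nat.pair (x + y + L + 1) (if a / 2 ^ y % 2 = 1 then a else a + 2 ^ x)

/-- At stage `m = ⟨e, ⟨L, a⟩⟩`, search for an undecided `x` with `φ_e x ≠ x`. -/
def search (m k : ℕ) : Option ℕ :=
  -- `k` pairs the candidate `x` with a bound for the evaluation.
  (Code.evaln k.unpair.2 (Denumerable.ofNat Code m.unpair.1) k.unpair.1).bind fun y =>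
    if m.unpair.2.unpair.1 ≤ k.unpair.1 ∧ y ≠ k.unpair.1 then
      some (separate m.unpair.2.unpair.1 m.unpair.2.unpair.2 k.unpair.1 y)
    else none

/-- The outcome of a failed search. One more number is decided, as a non-element, so that `len`
grows at every stage. -/
def skip (m : ℕ) : ℕ := Nat.pair (m.unpair.2.unpair.1 + 1) m.unpair.2.unpair.2

/-- The initial state `0` is the pair `⟨0, 0⟩`: nothing decided, no elements. -/
noncomputable def state : ℕ → ℕ := stageState (searchOrElse search skip)

noncomputable def len (n : ℕ) : ℕ := (state n).unpair.1

noncomputable def bits (n : ℕ) : ℕ := (state n).unpair.2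

theorem primrec_pow : Primrec₂ ((· ^ ·) : ℕ → ℕ → ℕ) :=
  Primrec₂.unpaired'.1 Nat.Primrec.pow

theorem primrec_testBit : Primrec₂ fun a y : ℕ => a / 2 ^ y % 2 :=
  Primrec.nat_mod.comp₂ (Primrec.nat_div.comp₂ Primrec₂.left
    (primrec_pow.comp₂ (Primrec₂.const 2) Primrec₂.right)) (Primrec₂.const 2)

theorem primrec_search : Primrec₂ search := by
  have u1 {f : ℕ × ℕ → ℕ} (hf : Primrec f) : Primrec fun p => (f p).unpair.1 :=
    Primrec.fst.comp (Primrec.unpair.comp hf)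
  have u2 {f : ℕ × ℕ → ℕ} (hf : Primrec f) : Primrec fun p => (f p).unpair.2 :=
    Primrec.snd.comp (Primrec.unpair.comp hf)
  have hx := u1 (Primrec.snd (α := ℕ) (β := ℕ))
  have hL := u1 (u2 (Primrec.fst (α := ℕ) (β := ℕ)))
  have ha := u2 (u2 (Primrec.fst (α := ℕ) (β := ℕ)))
  refine Primrec.option_bind (Code.primrec_evaln.comp (((u2 Primrec.snd).pair
    ((Primrec.ofNat Code).comp (u1 Primrec.fst))).pair hx)) ?_
  have hx' := hx.comp (Primrec.fst (α := ℕ × ℕ) (β := ℕ))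
  have hL' := hL.comp (Primrec.fst (α := ℕ × ℕ) (β := ℕ))
  have ha' := ha.comp (Primrec.fst (α := ℕ × ℕ) (β := ℕ))
  have hy := Primrec.snd (α := ℕ × ℕ) (β := ℕ)
  refine Primrec.ite (((Primrec.nat_le.comp hL' hx').and (Primrec.eq.comp hy hx').not))
    (Primrec.option_some.comp (Primrec₂.natPair.comp ?_ ?_)) (Primrec.const none)
  · exact Primrec.succ.comp (Primrec.nat_add.comp (Primrec.nat_add.comp hx' hy) hL')
  · exact Primrec.ite (Primrec.eq.comp (primrec_testBit.comp ha' hy) (Primrec.const 1)) ha'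
      (Primrec.nat_add.comp ha' (primrec_pow.comp (Primrec.const 2) hx'))

theorem primrec_skip : Primrec skip := by
  have h := Primrec.unpair.comp (Primrec.snd.comp Primrec.unpair)
  exact Primrec₂.natPair.comp (Primrec.succ.comp (Primrec.fst.comp h)) (Primrec.snd.comp h)

theorem recursiveIn_state :
    Nat.RecursiveIn {(charFun emptyJump : ℕ →. ℕ)} (state : ℕ →. ℕ) :=
  recursiveIn_stageState (recursiveIn_searchOrElse primrec_search.to_comp primrec_skip.to_comp)

/-- What happens at stage `e`. -/
theorem stage_cases (e : ℕ) :
    (∃ x y, y ∈ (Denumerable.ofNat Code e).eval x ∧ len e ≤ x ∧ y ≠ x ∧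
      len (e + 1) = x + y + len e + 1 ∧
      bits (e + 1) = if (bits e).testBit y then bits e else bits e + 2 ^ x) ∨
    (len (e + 1) = len e + 1 ∧ bits (e + 1) = bits e ∧
      ∀ x, len e ≤ x → ∀ y ∈ (Denumerable.ofNat Code e).eval x, y = x) := by
  have hs : state (e + 1) = searchOrElse search skip (Nat.pair e (state e)) := rfl
  rcases searchOrElse_spec search skip (Nat.pair e (state e)) with ⟨k, hk⟩ | ⟨hd, hk⟩
  · left
    rw [← hs] at hk
    simp only [search, Nat.unpair_pair, Option.mem_def, Option.bind_eq_some_iff,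
      Option.ite_none_right_eq_some, Option.some.injEq] at hk
    obtain ⟨y, hy, ⟨h1, h2⟩, h3⟩ := hk
    refine ⟨k.unpair.1, y, Code.evaln_sound hy, h1, h2, ?_, ?_⟩
    · simp [len, ← h3, separate]
    · simp [bits, ← h3, separate, Nat.testBit_eq_decide_div_mod_eq]
  · right
    rw [← hs] at hd
    refine ⟨by simp [len, hd, skip], by simp [bits, hd, skip], fun x hx y hy => ?_⟩
    obtain ⟨j, hj⟩ := Code.evaln_complete.1 hy
    have := hk (Nat.pair x j)
    rw [Option.mem_def] at hj
    simp only [search, Nat.unpair_pair, hj, Option.bind_some, ite_eq_right_iff] at this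
    by_contra hne
    exact absurd (this ⟨hx, hne⟩) (by simp)

theorem bits_lt (e : ℕ) : bits e < 2 ^ len e := by
  induction e with
  | zero => simp [bits, len, state, stageState]
  | succ e ih =>
    rcases stage_cases e with ⟨x, y, -, hx, -, hl, hb⟩ | ⟨hl, hb, -⟩
    · have h1 : (2:ℕ) ^ len e ≤ 2 ^ x := Nat.pow_le_pow_right two_pos hx
      have h2 : (2:ℕ) ^ (x + 1) ≤ 2 ^ len (e + 1) := Nat.pow_le_pow_right two_pos (by omega)
      rw [pow_succ] at h2
      rw [hb]
      split_ifs <;> omega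
    · rw [hl, hb, pow_succ]; omega

theorem testBit_bits_eq_false {e n : ℕ} (h : len e ≤ n) : (bits e).testBit n = false :=
  Nat.testBit_lt_two_pow ((bits_lt e).trans_le (Nat.pow_le_pow_right two_pos h))

/-- All bits of `bits e` lie below `len e ≤ x`, so the addition has no carry. -/
theorem testBit_add_two_pow {e x n : ℕ} (hx : len e ≤ x) :
    (bits e + 2 ^ x).testBit n = ((bits e).testBit n || decide (x = n)) := by
  have hlt : bits e < 2 ^ x := (bits_lt e).trans_le (Nat.pow_le_pow_right two_pos hx)
  rw [add_comm, show 2 ^ x + bits e = 2 ^ x ||| bits e by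
    simpa using Nat.two_pow_add_eq_or_of_lt hlt 1]
  simp [Nat.testBit_or, Nat.testBit_two_pow, Bool.or_comm]

theorem len_lt_len_succ (e : ℕ) : len e < len (e + 1) := by
  rcases stage_cases e with ⟨x, y, -, -, -, hl, -⟩ | ⟨hl, -⟩ <;> omega

theorem strictMono_len : StrictMono len := strictMono_nat_of_lt_succ len_lt_len_succ

theorem testBit_bits_succ {e n : ℕ} (h : n < len e) :
    (bits (e + 1)).testBit n = (bits e).testBit n := by
  rcases stage_cases e with ⟨x, y, -, hx, -, -, hb⟩ | ⟨-, hb, -⟩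
  · rw [hb]
    split_ifs
    · rfl
    · rw [testBit_add_two_pow hx]
      simp [show x ≠ n by omega]
  · rw [hb]

theorem testBit_bits_of_le {e e' n : ℕ} (he : e ≤ e') (h : n < len e) :
    (bits e').testBit n = (bits e).testBit n := by
  induction e', he using Nat.le_induction with
  | base => rfl
  | succ k hk ih => rw [testBit_bits_succ (h.trans_le (strictMono_len.monotone hk)), ih]

/-- The set built by the construction. -/
def rigidSet : Set ℕ := {n | (bits (n + 1)).testBit n}

theorem mem_rigidSet_iff {e n : ℕ} (h : n < len e) : n ∈ rigidSet ↔ (bits e).testBit n := by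
  have h' : n < len (n + 1) := (strictMono_len.id_le (n + 1))
  rw [rigidSet, Set.mem_ofPred_eq, ← testBit_bits_of_le (le_max_left (n + 1) e) h',
    ← testBit_bits_of_le (le_max_right (n + 1) e) h]

/-- Stage `e`, for a code `e` of `f`, settles `f`. A successful search puts `x` and `f x` on
different sides: a still undecided `f x` has bit `0` and stays out while `x` enters. A failed search
says that `f` fixes everything from `len e` on. -/
theorem isRigid_rigidSet : IsRigid rigidSet := by
  intro f hf hred
  obtain ⟨c, hc⟩ := Code.exists_code.1 (Partrec.nat_iff.1 hf.partrec)
  set e := Encodable.encode c with he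
  have hcode : (Denumerable.ofNat Code e).eval = (f : ℕ →. ℕ) := by simp [he, hc]
  rcases stage_cases e with ⟨x, y, hy, hx, hne, hl, hb⟩ | ⟨-, -, h⟩
  · exfalso
    have hyx : y = f x := by simpa [hcode] using hy
    have := hred x
    rw [← hyx, mem_rigidSet_iff (e := e + 1) (by omega), mem_rigidSet_iff (e := e + 1) (by omega),
      hb] at this
    by_cases hty : (bits e).testBit y
    · simp [hty, testBit_bits_eq_false hx] at this
    · simp [hty, testBit_add_two_pow hx, hne.symm] at this
  · exact ⟨len e, fun x hx => (h x hx (f x) (by simp [hcode]))⟩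

end RigidConstruction

/-! ### Rigid sets are not recursive -/

theorem IsRigid.exists_notMem {A : Set ℕ} (hA : IsRigid A) : ∃ b, b ∉ A := by
  by_contra! h
  obtain ⟨L, hL⟩ := hA _ Computable.succ fun x => by simp [h]
  exact absurd (hL L le_rfl) (Nat.succ_ne_self L)

theorem IsRigid.nonempty {A : Set ℕ} (hA : IsRigid A) : A.Nonempty := by
  by_contra! h
  obtain ⟨L, hL⟩ := hA _ Computable.succ fun x => by simp [h]
  exact absurd (hL L le_rfl) (Nat.succ_ne_self L)

/-- A decidable set containing `a` and omitting `b` has a computable self-reduction with values in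
`{a, b}`, which cannot fix large numbers. -/
theorem IsRigid.not_isRecursive {A : Set ℕ} (hA : IsRigid A) : ¬ IsRecursive A := by
  rintro ⟨_, hc⟩
  obtain ⟨b, hb⟩ := hA.exists_notMem
  obtain ⟨a, ha⟩ := hA.nonempty
  obtain ⟨L, hL⟩ := hA (fun x => bif decide (x ∈ A) then a else b)
    (Computable.cond hc (Computable.const a) (Computable.const b)) fun x => by
      by_cases h : x ∈ A <;> simp [h, ha, hb]
  have := hL (L + a + b + 1) (by omega)
  by_cases h : L + a + b + 1 ∈ A <;> simp [h] at this <;> omega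

/-! ### Duplications of a set and their 1-reducibility -/

/-- Two copies of each element of `A` on which `s` holds and one copy of the others, together with
an infinite computable supply of non-elements. -/
def duplicate (A : Set ℕ) (s : ℕ → Bool) : Set ℕ :=
  {n | (n % 3 = 0 ∨ n % 3 = 1 ∧ s (n / 3)) ∧ n / 3 ∈ A}

theorem mem_duplicate {A : Set ℕ} {s : ℕ → Bool} {n : ℕ} :
    n ∈ duplicate A s ↔ (n % 3 = 0 ∨ n % 3 = 1 ∧ s (n / 3)) ∧ n / 3 ∈ A := Iff.rfl

theorem primrec_div_const (m : ℕ) : Primrec fun n : ℕ => n / m :=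
  Primrec.nat_div.comp Primrec.id (Primrec.const m)

theorem primrec_mod_const (m : ℕ) : Primrec fun n : ℕ => n % m :=
  Primrec.nat_mod.comp Primrec.id (Primrec.const m)

theorem primrec_mod_beq_const (m k : ℕ) : Primrec fun n : ℕ => n % m == k :=
  Primrec.beq.comp (primrec_mod_const m) (Primrec.const k)

theorem primrec_mul_add_const (a b : ℕ) : Primrec fun n : ℕ => a * n + b :=
  Primrec.nat_add.comp (Primrec.nat_mul.comp (Primrec.const a) Primrec.id) (Primrec.const b)

theorem computable_live {s : ℕ → Bool} (hs : Computable s) :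
    Computable fun n => n % 3 == 0 || (n % 3 == 1 && s (n / 3)) :=
  (Primrec.or.to_comp).comp (primrec_mod_beq_const 3 0).to_comp
    ((Primrec.and.to_comp).comp (primrec_mod_beq_const 3 1).to_comp
      (hs.comp (primrec_div_const 3).to_comp))

/-- Positions live for `s` stay put. All others go injectively into the residue class `2` modulo
`3`, which holds no elements and no live positions. -/
theorem duplicate_oneReducible {A : Set ℕ} {s t : ℕ → Bool} (hs : Computable s)
    (h : ∀ x, s x → t x) : OneReducible (duplicate A s) (duplicate A t) := by
  refine ⟨fun n => bif n % 3 == 0 || (n % 3 == 1 && s (n / 3)) then n else 3 * n + 2,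
    Computable.cond (computable_live hs) Computable.id (primrec_mul_add_const 3 2).to_comp,
    fun m n hmn => ?_, fun n => ?_⟩
  · simp only [Bool.cond_eq_ite] at hmn
    split_ifs at hmn with h1 h2 h2
    · exact hmn
    · simp at h1; omega
    · simp at h2; omega
    · omega
  · by_cases h1 : (n % 3 == 0 || (n % 3 == 1 && s (n / 3))) = true
    · have h2 : n % 3 = 0 ∨ n % 3 = 1 ∧ s (n / 3) = true := by simpa using h1
      simp only [h1, cond_true, mem_duplicate]
      have h3 : n % 3 = 0 ∨ n % 3 = 1 ∧ t (n / 3) = true := h2.imp_right fun h' => ⟨h'.1, h _ h'.2⟩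
      simp [h2, h3]
    · have h2 : ¬ (n % 3 = 0 ∨ n % 3 = 1 ∧ s (n / 3) = true) := by simpa using h1
      have h3 : (3 * n + 2) % 3 = 2 := by omega
      simp only [Bool.not_eq_true] at h1
      simp [h1, mem_duplicate, h2, h3]

theorem OneReducible.trans_bfoReducible {A B C : Set ℕ} (h : OneReducible A B)
    (k : BFOReducible B C) : BFOReducible A C := by
  obtain ⟨f, hf, hinj, hred⟩ := h
  obtain ⟨g, c, hg, hc, hgred, hfib⟩ := k
  refine ⟨fun x => g (f x), c, hg.comp hf, hc, fun x => (hred x).trans (hgred _), fun y => ?_⟩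
  refine le_trans ?_ (hfib y)
  rw [← hinj.encard_image]
  exact Set.encard_le_encard (Set.image_preimage_subset f (g ⁻¹' {y}))

theorem OneReducible.bfoReducible {A B : Set ℕ} (h : OneReducible A B) : BFOReducible A B :=
  h.trans_bfoReducible ⟨id, 1, Computable.id, le_rfl, fun _ => Iff.rfl, fun y => by simp⟩

theorem duplicate_true_bfoReducible (A : Set ℕ) :
    BFOReducible (duplicate A fun _ => true) (duplicate A fun _ => false) := by
  refine ⟨fun n => bif n % 3 == 1 then n - 1 else n, 2,
    (Primrec.cond (primrec_mod_beq_const 3 1) Primrec.pred Primrec.id).to_comp, one_le_two,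
    fun n => ?_, fun y => ?_⟩
  · by_cases h : n % 3 = 1
    · have h1 : (n - 1) % 3 = 0 := by omega
      have h2 : (n - 1) / 3 = n / 3 := by omega
      simp [mem_duplicate, h, h1, h2]
    · simp [mem_duplicate, h, Bool.cond_eq_ite]
  · refine (Set.encard_le_encard (t := {y, y + 1}) fun n hn => ?_).trans (Set.encard_pair (Nat.ne_add_one y)).le
    by_cases h : n % 3 = 1
    · have : n - 1 = y := by simpa [h] using hn
      simp; omega
    · have : n = y := by simpa [h, Bool.cond_eq_ite] using hn
      simp [this]

/-- Every `duplicate A s` lies, under `≤_1`, between the duplications for the constants `false` and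
`true`, and the top one folds back onto the bottom one. -/
theorem mem_bfoDegree_of_equiv_duplicate {A B : Set ℕ} {s : ℕ → Bool} (hs : Computable s)
    (h : OneReducible B (duplicate A s)) (h' : OneReducible (duplicate A s) B) :
    B ∈ bfoDegree (duplicate A fun _ => false) := by
  constructor
  · exact OneReducible.trans_bfoReducible
      (OneOneReducible.trans h (duplicate_oneReducible hs fun _ _ => rfl))
      (duplicate_true_bfoReducible A)
  · exact OneReducible.bfoReducible
      (OneOneReducible.trans (duplicate_oneReducible (Computable.const false) (by simp)) h')

/-- Following either copy of `x` through the reduction and then back to `A` by `base` gives a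
self-reduction of `A`. By rigidity, both copies of a large `x` in `s` land on copies of `x`. If `x`
is not in `t`, only one such position exists, against injectivity. -/
theorem IsRigid.eventually_imp_of_duplicate_oneReducible {A : Set ℕ} (hA : IsRigid A)
    {s t : ℕ → Bool} (hs : Computable s) (ht : Computable t)
    (h : OneReducible (duplicate A s) (duplicate A t)) :
    ∃ L, ∀ x, L ≤ x → s x → t x := by
  obtain ⟨b, hb⟩ := hA.exists_notMem
  obtain ⟨φ, hφ, hinj, hred⟩ := h
  replace hred : ∀ n, n ∈ duplicate A s ↔ φ n ∈ duplicate A t := hred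
  let base : ℕ → ℕ := fun n => bif n % 3 == 0 || (n % 3 == 1 && t (n / 3)) then n / 3 else b
  have hbase : Computable base :=
    Computable.cond (computable_live ht) (primrec_div_const 3).to_comp (Computable.const b)
  have hmem (n : ℕ) : n ∈ duplicate A t ↔ base n ∈ A := by
    by_cases h1 : n % 3 = 0 ∨ n % 3 = 1 ∧ t (n / 3) = true
    · have h2 : (n % 3 == 0 || (n % 3 == 1 && t (n / 3))) = true := by simpa using h1
      simp [base, mem_duplicate, h1, h2]
    · have h2 : (n % 3 == 0 || (n % 3 == 1 && t (n / 3))) = false := by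
        rw [← Bool.not_eq_true]; simpa using h1
      simp [base, mem_duplicate, h1, h2, hb]
  -- Dead positions have base `b`, so for `x ≠ b` outside `t` the only position over `x` is `3 * x`.
  have hlive {n x : ℕ} (hx : x ≠ b) (htx : ¬ t x) (hn : base n = x) : n = 3 * x := by
    simp only [base, Bool.cond_eq_ite] at hn
    split_ifs at hn with h1
    · rw [hn] at h1
      simp [htx] at h1
      omega
    · exact absurd hn.symm hx
  obtain ⟨L₀, h₀⟩ := hA (fun x => base (φ (3 * x)))
    (hbase.comp (hφ.comp (primrec_mul_add_const 3 0).to_comp)) fun x => by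
      rw [← hmem, ← hred]
      simp [duplicate]
  -- Outside `s` there is no second copy to follow; the identity there keeps the map a
  -- self-reduction.
  obtain ⟨L₁, h₁⟩ := hA (fun x => bif s x then base (φ (3 * x + 1)) else x)
    (Computable.cond hs (hbase.comp (hφ.comp (primrec_mul_add_const 3 1).to_comp))
      Computable.id) fun x => by
      by_cases hsx : s x
      · have h1 : (3 * x + 1) % 3 = 1 := by omega
        have h2 : (3 * x + 1) / 3 = x := by omega
        simp only [hsx, cond_true]
        rw [← hmem, ← hred]
        simp [duplicate, h1, h2, hsx]
      · simp [hsx]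
  refine ⟨L₀ + L₁ + b + 1, fun x hx hsx => ?_⟩
  by_contra htx
  have e₀ := hlive (by omega) htx (h₀ x (by omega))
  have e₁ := hlive (by omega) htx (by simpa [hsx] using h₁ x (by omega))
  exact absurd (hinj (e₀.trans e₁.symm)) (by omega)

theorem IsRigid.not_isRecursive_duplicate {A : Set ℕ} (hA : IsRigid A) (s : ℕ → Bool) :
    ¬ IsRecursive (duplicate A s) := fun h => by
  refine hA.not_isRecursive (ComputablePred.computable_of_manyOneReducible
    ⟨fun x => 3 * x, (primrec_mul_add_const 3 0).to_comp, fun x => ?_⟩ h)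
  simp [duplicate]

namespace RigidConstruction

theorem setTuringReducible_duplicate :
    SetTuringReducible (duplicate rigidSet fun _ => false) emptyJump := by
  have hG : Nat.Primrec fun p => if p.unpair.1 % 3 = 0 then
      p.unpair.2.unpair.2 / 2 ^ (p.unpair.1 / 3) % 2 else 0 := by
    rw [← Primrec.nat_iff]
    have h1 := Primrec.fst.comp Primrec.unpair
    have h2 := Primrec.snd.comp (Primrec.unpair.comp (Primrec.snd.comp Primrec.unpair))
    exact Primrec.ite (Primrec.eq.comp ((primrec_mod_const 3).comp h1) (Primrec.const 0))
      (primrec_testBit.comp h2 ((primrec_div_const 3).comp h1)) (Primrec.const 0)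
  have hI : Nat.RecursiveIn {(charFun emptyJump : ℕ →. ℕ)} ((id : ℕ → ℕ) : ℕ →. ℕ) :=
    Nat.Primrec.id.recursiveIn
  have hS : Nat.RecursiveIn {(charFun emptyJump : ℕ →. ℕ)}
      ((fun n => state (n + 1) : ℕ → ℕ) : ℕ →. ℕ) :=
    recursiveIn_state.comp_total Nat.RecursiveIn.succ
  rw [SetTuringReducible, TuringReducible, RecursiveIn.iff_nat]
  refine (hG.recursiveIn.comp_total (hI.pair_total hS)).of_eq fun n => ?_
  have hlt : n / 3 < len (n + 1) :=
    (Nat.lt_succ_of_le (Nat.div_le_self n 3)).trans_le (strictMono_len.id_le (n + 1))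
  have hmem := mem_rigidSet_iff hlt
  rw [Nat.testBit_eq_decide_div_mod_eq, decide_eq_true_iff] at hmem
  have h2 : bits (n + 1) / 2 ^ (n / 3) % 2 < 2 := Nat.mod_lt _ two_pos
  by_cases h3 : n % 3 = 0
  · by_cases h4 : n / 3 ∈ rigidSet
    · have := hmem.1 h4
      simp [charFun, duplicate, h3, h4]
      exact this
    · have : bits (n + 1) / 2 ^ (n / 3) % 2 = 0 := by
        have := hmem.not.1 h4
        omega
      simp [charFun, duplicate, h3, h4]
      exact this
  · simp [charFun, duplicate, h3]

end RigidConstruction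

/-! ### Representing a preorder by computable sets -/

/-- The up-set of the preorder `r` on `ℕ` guided by the binary digits of `x`: the number `n` is put
in if its predecessors force it, and if its predecessors permit it and the digit asks for it. -/
def guidedUpSet (r : ℕ → ℕ → Prop) (x n : ℕ) : Prop :=
  (∃ i, ∃ _ : i < n, r i n ∧ guidedUpSet r x i) ∨
    ((∀ i, ∀ _ : i < n, r n i → guidedUpSet r x i) ∧ x.testBit n)
termination_by n

/-- Only the digits up to `n` matter. For fixed `n` the predicate is thus periodic in `x`, hence
computable even when `r` is not. -/
theorem guidedUpSet_congr {r : ℕ → ℕ → Prop} {x y n : ℕ}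
    (h : ∀ k, k ≤ n → x.testBit k = y.testBit k) : guidedUpSet r x n ↔ guidedUpSet r y n := by
  induction n using Nat.strong_induction_on with
  | _ n ih =>
    have ih' (i : ℕ) (hi : i < n) : guidedUpSet r x i ↔ guidedUpSet r y i :=
      ih i hi fun k hk => h k (hk.trans hi.le)
    rw [guidedUpSet, guidedUpSet, h n le_rfl]
    refine or_congr ?_ (and_congr_left' ?_)
    · exact exists_congr fun i => exists_congr fun hi => and_congr_right' (ih' i hi)
    · exact forall_congr' fun i => forall_congr' fun hi => imp_congr_right fun _ => ih' i hi

/-- For `i < j` the first clause forces `j` in. For `j < i`, either `i` was forced by a smaller `k`,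
which replaces it by transitivity, or the second clause required `j` to be in already. -/
theorem guidedUpSet_mono {r : ℕ → ℕ → Prop} (htrans : ∀ i j k, r i j → r j k → r i k)
    {x i j : ℕ} (hij : r i j) (hi : guidedUpSet r x i) : guidedUpSet r x j := by
  induction i using Nat.strong_induction_on with
  | _ i ih =>
    rcases lt_trichotomy i j with hlt | rfl | hlt
    · rw [guidedUpSet]
      exact Or.inl ⟨i, hlt, hij, hi⟩
    · exact hi
    · rw [guidedUpSet] at hi
      rcases hi with ⟨k, hk, hki, hk'⟩ | ⟨h, -⟩
      · exact ih k hk (htrans _ _ _ hki hij) hk'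
      · exact h j hlt hij

/-- Digits that already spell an up-set are never overruled by either clause. -/
theorem guidedUpSet_iff_mem {r : ℕ → ℕ → Prop} {U : Set ℕ}
    (hU : ∀ i j, r i j → i ∈ U → j ∈ U) {x n : ℕ} (h : ∀ k, k ≤ n → (x.testBit k ↔ k ∈ U)) :
    guidedUpSet r x n ↔ n ∈ U := by
  induction n using Nat.strong_induction_on with
  | _ n ih =>
    have ih' (i : ℕ) (hi : i < n) : guidedUpSet r x i ↔ i ∈ U :=
      ih i hi fun k hk => h k (hk.trans hi.le)
    rw [guidedUpSet]
    constructor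
    · rintro (⟨i, hi, hr, hx⟩ | ⟨-, hb⟩)
      · exact hU i n hr ((ih' i hi).1 hx)
      · exact (h n le_rfl).1 hb
    · exact fun hn => Or.inr ⟨fun i hi hr => (ih' i hi).2 (hU n i hr hn), (h n le_rfl).2 hn⟩

theorem exists_le_testBit_iff (U : Set ℕ) (N L : ℕ) :
    ∃ x, L ≤ x ∧ ∀ k, k < N → (x.testBit k ↔ k ∈ U) := by
  classical
  refine ⟨2 ^ N * L + Nat.ofBits fun i : Fin N => decide (i.1 ∈ U), ?_, fun k hk => ?_⟩
  · exact (Nat.le_mul_of_pos_left L (by positivity)).trans (Nat.le_add_right _ _)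
  · rw [Nat.testBit_two_pow_mul_add _ (Nat.ofBits_lt_two_pow _), if_pos hk,
      Nat.testBit_ofBits_lt _ _ hk]
    simp

theorem computable_of_mod {h : ℕ → Bool} (N : ℕ) (hN : 0 < N) (hmod : ∀ x, h (x % N) = h x) :
    Computable h := by
  have : Primrec fun x => ((List.range N).map h)[x % N]? :=
    Primrec.list_getElem?.comp (Primrec.const _) (primrec_mod_const N)
  refine ((Primrec.option_getD.comp this (Primrec.const false)).of_eq fun x => ?_).to_comp
  simp [Nat.mod_lt x hN, hmod]

open Classical in
/-- Computable sets whose inclusion order, up to finite differences, is a given preorder. -/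
theorem exists_computable_family {r : ℕ → ℕ → Prop} (hrefl : ∀ i, r i i)
    (htrans : ∀ i j k, r i j → r j k → r i k) :
    ∃ s : ℕ → ℕ → Bool, (∀ i, Computable (s i)) ∧ (∀ i j, r i j → ∀ x, s i x → s j x) ∧
      ∀ i j, (∃ L, ∀ x, L ≤ x → s i x → s j x) → r i j := by
  refine ⟨fun i x => decide (guidedUpSet r x i), fun i => ?_, fun i j hij x hx => ?_,
    fun i j ⟨L, hL⟩ => ?_⟩
  · refine computable_of_mod (2 ^ (i + 1)) (by positivity) fun x => ?_
    refine decide_eq_decide.2 (guidedUpSet_congr fun k hk => ?_)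
    simp [Nat.testBit_mod_two_pow, Nat.lt_succ_of_le hk]
  · simp only [decide_eq_true_eq] at hx ⊢
    exact guidedUpSet_mono htrans hij hx
  -- The digits spell the principal up-set of `i`. It contains `i`, so the inclusion at this large
  -- `x` puts `j` in it, which is `r i j`.
  · obtain ⟨x, hx, hbits⟩ := exists_le_testBit_iff {k | r i k} (i + j + 1) L
    have hU : ∀ k l, r k l → k ∈ {k | r i k} → l ∈ {k | r i k} :=
      fun k l hkl hk => htrans _ _ _ hk hkl
    have h := hL x hx
    simp only [decide_eq_true_eq] at h
    rw [guidedUpSet_iff_mem hU fun k hk => hbits k (by omega),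
      guidedUpSet_iff_mem hU fun k hk => hbits k (by omega)] at h
    exact h (hrefl i)

/-! ### Embedding countable partial orders -/

theorem corollary3p10 :
    ∃ A : Set ℕ, ¬ IsRecursive A ∧ SetTuringReducible A emptyJump ∧
      ∀ (P : Type*) [PartialOrder P] [Countable P], Nonempty (P ↪o oneDegreesIn A) := by
  have hrigid := RigidConstruction.isRigid_rigidSet
  refine ⟨duplicate RigidConstruction.rigidSet fun _ => false,
    hrigid.not_isRecursive_duplicate _, RigidConstruction.setTuringReducible_duplicate, ?_⟩
  intro P _ _
  obtain ⟨enc, henc⟩ := exists_injective_nat P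
  -- The order of `P` is carried to `ℕ` along `enc`; the clause `i = j` makes it reflexive off the
  -- range of `enc`.
  obtain ⟨s, hs, hmono, hrefl⟩ := exists_computable_family
    (r := fun i j => i = j ∨ ∃ p q, enc p = i ∧ enc q = j ∧ p ≤ q) (fun i => Or.inl rfl) (by
      rintro i j k (rfl | ⟨p, q, rfl, rfl, hpq⟩) hjk
      · exact hjk
      · rcases hjk with rfl | ⟨q', t, hq, rfl, hqt⟩
        · exact Or.inr ⟨p, q, rfl, rfl, hpq⟩
        · rw [henc hq] at hqt
          exact Or.inr ⟨p, t, rfl, rfl, hpq.trans hqt⟩)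
  refine ⟨OrderEmbedding.ofMapLEIff (fun p =>
    ⟨oneDeg (duplicate RigidConstruction.rigidSet (s (enc p))), fun B hB => ?_⟩) fun p q => ?_⟩
  · have h := Quotient.exact hB
    exact mem_bfoDegree_of_equiv_duplicate (hs _) h.1 h.2
  · change OneReducible _ _ ↔ p ≤ q
    constructor
    · intro h
      rcases hrefl _ _ (hrigid.eventually_imp_of_duplicate_oneReducible (hs _) (hs _) h) with
        h | ⟨p', q', hp, hq, hle⟩
      · exact (henc h).le
      · rwa [henc hp, henc hq] at hle
    · exact fun h => duplicate_oneReducible (hs _) (hmono _ _ (Or.inr ⟨p, q, rfl, rfl, h⟩))
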